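/- Let $\mathbb D=\{z\in\mathbb C:|z|<1\}$ and let the tetrablock be $$\mathbb E=\{(x_1,x_2,x_3)\in\mathbb C^3 : 1-zx_1-wx_2+zwx_3\neq 0 \text{ for all } z,w\in\overline{\mathbb D}\},$$ with closure $\overline{\mathbb E}$ in $\mathbb C^3$. For $x=(x_1,x_2,x_3)\in\mathbb C^3$ put $$\Psi(z,x)=\frac{x_3z-x_1}{x_2z-1},\qquad \Upsilon(z,x)=\Psi(z,(x_2,x_1,x_3))=\frac{x_3z-x_2}{x_1z-1},$$ where $\Psi(\cdot,x)$ (respectively $\Upsilon(\cdot,x)$) is read as the constant $x_1$ (respectively $x_2$) if $x_1x_2=x_3$, and $\|f\|_{H^\infty}=\sup_{z\in\mathbb D}|f(z)|$. The $2\times2$ Schur class is the set of analytic functions $F:\mathbb D\to M_2(\mathbb C)$ with operator norm $\|F(z)\|\le 1$ for all $z\in\mathbb D$. **Theorem 1.1.** Let $\lambda_0\in\mathbb D\setminus\{0\}$ and $x=(a,b,p)\in\mathbb E$. Then the following conditions are equivalent: - $(1)$ there is an analytic function $\varphi:\mathbb D\to\overline{\mathbb E}$ with $\varphi(0)=(0,0,0)$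 and $\varphi(\lambda_0)=x$; - $(1')$ there is an analytic function $\varphi:\mathbb D\to\mathbb E$ with $\varphi(0)=(0,0,0)$ and $\varphi(\lambda_0)=x$; - $(2)$ $\displaystyle\max\left\{\frac{|a-\bar bp|+|ab-p|}{1-|b|^2},\ \frac{|b-\bar ap|+|ab-p|}{1-|a|^2}\right\}\le|\lambda_0|$; - $(3)$ either $|b|\le|a|$ and $\displaystyle\frac{|a-\bar bp|+|ab-p|}{1-|b|^2}\le|\lambda_0|$, or $|a|\le|b|$ and $\displaystyle\frac{|b-\bar ap|+|ab-p|}{1-|a|^2}\le|\lambda_0|$; - $(4)$ there is a function $F$ in the $2\times2$ Schur class such that $F(0)=\begin{bmatrix}0&*\\0&0\end{bmatrix}$ (with $*$ an arbitrary complex number) and $F(\lambda_0)=A=[a_{ij}]$, where $x=(a_{11},a_{22},\det A)$; - $(5)$ either $|b|\le|a|$ and $\|\Psi(\cdot,x)\|_{H^\infty}\le|\lambda_0|$, or $|a|\le|b|$ and $\|\Upsilon(\cdot,x)\|_{H^\infty}\le|\lambda_0|$; - $(6)$ either $|b|\le|a|$ and $|a|^2-|\lambda_0|^2|b|^2+|p|^2+2\big||\lambda_0|^2b-\bar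 ap\big|\le|\lambda_0|^2$, or $|a|\le|b|$ and $|b|^2-|\lambda_0|^2|a|^2+|p|^2+2\big||\lambda_0|^2a-\bar bp\big|\le|\lambda_0|^2$; - $(7)$ either $\lambda_0-az-b\lambda_0w+pzw\ne0$ for all $z,w\in\mathbb D$ and $|b|\le|a|$, or $\lambda_0-a\lambda_0z-bw+pzw\ne0$ for all $z,w\in\mathbb D$ and $|a|\le|b|$; - $(8)$ either $|b|\le|a|$ and $|\lambda_0||a-\bar bp|+\big||\lambda_0|^2b-\bar ap\big|+|p|^2\le|\lambda_0|^2$, or $|a|\le|b|$ and $|\lambda_0||b-\bar ap|+\big||\lambda_0|^2a-\bar bp\big|+|p|^2\le|\lambda_0|^2$; - $(9)$ either $|b|\le|a|$, $|p|\le|\lambda_0|$ and $|a|^2+|\lambda_0b|^2-|p|^2+2|\lambda_0||ab-p|\le|\lambda_0|^2$, or $|a|\le|b|$, $|p|\le|\lambda_0|$ and $|b|^2+|\lambda_0a|^2-|p|^2+2|\lambda_0||ab-p|\le|\lambda_0|^2$; - $(10)$ either $|b|\le|a|$, $|p|\le|\lambda_0|$ and there are $\beta_1,\beta_2\in\mathbb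 C$ with $|\beta_1|+|\beta_2|\le1$, $a=\beta_1\lambda_0+\bar\beta_2p$ and $b\lambda_0=\beta_2\lambda_0+\bar\beta_1p$; or $|a|\le|b|$, $|p|\le|\lambda_0|$ and there are $\beta_1,\beta_2\in\mathbb C$ with $|\beta_1|+|\beta_2|\le1$, $a\lambda_0=\beta_1\lambda_0+\bar\beta_2p$ and $b=\beta_2\lambda_0+\bar\beta_1p$. -/

import Mathlib

open scoped ComplexConjugate ENNReal

/-- The open unit disc in `ℂ`. -/
abbrev unitDisc : Set ℂ := Metric.ball (0 : ℂ) 1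

/-- The tetrablock: all `(x₁, x₂, x₃)` such that `1 - z x₁ - w x₂ + z w x₃` has no zero with
`z, w` in the closed unit disc. -/
def tetrablock : Set (ℂ × ℂ × ℂ) :=
  {x | ∀ z w : ℂ, ‖z‖ ≤ 1 → ‖w‖ ≤ 1 → 1 - z * x.1 - w * x.2.1 + z * w * x.2.2 ≠ 0}

open Classical in
/-- `Ψ(z, x) = (x₃ z - x₁) / (x₂ z - 1)`, read as the constant `x₁` when `x₁ x₂ = x₃`. -/
noncomputable def tetraPsi (z : ℂ) (x : ℂ × ℂ × ℂ) : ℂ :=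
  if x.1 * x.2.1 = x.2.2 then x.1 else (x.2.2 * z - x.1) / (x.2.1 * z - 1)

/-- `Υ(z, (x₁, x₂, x₃)) = Ψ(z, (x₂, x₁, x₃))`. -/
noncomputable def tetraUpsilon (z : ℂ) (x : ℂ × ℂ × ℂ) : ℂ :=
  tetraPsi z (x.2.1, x.1, x.2.2)

/-- The `H^∞` norm: the supremum of `|f|` over the open unit disc, with values in `[0, ∞]`. -/
noncomputable def hInftyNorm (f : ℂ → ℂ) : ℝ≥0∞ :=
  ⨆ z ∈ unitDisc, ‖f z‖ₑ

/-- The `2 × 2` Schur class: matrix functions that are analytic on the open unit disc (entry by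
entry) and whose values there have operator norm (on Euclidean `ℂ²`) at most one. Values outside
the disc are irrelevant. -/
def IsSchurClass (F : ℂ → Matrix (Fin 2) (Fin 2) ℂ) : Prop :=
  (∀ i j, AnalyticOnNhd ℂ (fun z => F z i j) unitDisc) ∧
    ∀ z ∈ unitDisc, ‖Matrix.toEuclideanCLM (n := Fin 2) (𝕜 := ℂ) (F z)‖ ≤ 1

/-! Write `r = ‖l‖`, `A = a - conj b * p`, `D = a * b - p`. Everything passes through the inequality
`‖A‖ + ‖D‖ ≤ r * (1 - ‖b‖ ^ 2)` and its mirror image under exchanging `a` and `b`. The map `w ↦ (p w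
- a) / (b w - 1)` sends the unit disc onto a disc of centre `A / (1 - ‖b‖ ^ 2)` and radius `‖D‖ / (1
- ‖b‖ ^ 2)` (a point if `D = 0`), so the inequality says exactly that this map is bounded by `r`.
The other scalar conditions restate that bound.

Necessity is the Schwarz lemma: for fixed `w`, compose a map into the closed tetrablock with this
fractional map (`disc_bound_of_exists_map_to_closure`). Both inequalities follow.

For sufficiency only the inequality attached to the coordinate of larger modulus is available.
Divide a factor `l` out of that coordinate and of `p`, complete the result to a 2 × 2 matrix of norm
one, and move it inside an explicit family of contractions until the remaining diagonal entry
vanishes at the origin (`exists_interpolant`); `‖b‖ ≤ ‖a‖` is what makes this possible. Putting the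
factor `z` back gives the Schur function. Its diagonal and determinant give a map into the open
tetrablock, again by the Schwarz lemma (`exists_map_to_tetrablock_of_schur`). -/

/-! ### Elementary bounds on the tetrablock and norm identities. -/

theorem norm_lt_one_of_mem_tetrablock {x : ℂ × ℂ × ℂ} (hx : x ∈ tetrablock) :
    ‖x.1‖ < 1 ∧ ‖x.2.1‖ < 1 := by
  constructor
  · by_contra! h
    have h0 : x.1 ≠ 0 := by
      intro h0
      rw [h0, norm_zero] at h
      linarith
    exact hx x.1⁻¹ 0 (by rw [norm_inv]; exact inv_le_one_of_one_le₀ h) (by simp) (by simp [h0])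
  · by_contra! h
    have h0 : x.2.1 ≠ 0 := by
      intro h0
      rw [h0, norm_zero] at h
      linarith
    exact hx 0 x.2.1⁻¹ (by simp) (by rw [norm_inv]; exact inv_le_one_of_one_le₀ h) (by simp [h0])

theorem swap_mem_tetrablock {a b p : ℂ} (h : (a, b, p) ∈ tetrablock) :
    (b, a, p) ∈ tetrablock := by
  intro z w hz hw h0
  exact h w z hw hz (by simp only at h0 ⊢; linear_combination h0)

/-- If the bound failed, solving the defining polynomial for `z` would give a root in the closed
disc. -/
theorem norm_sub_le_of_mem_tetrablock {x : ℂ × ℂ × ℂ} (hx : x ∈ tetrablock) {w : ℂ}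
    (hw : ‖w‖ ≤ 1) : ‖x.2.2 * w - x.1‖ ≤ ‖1 - x.2.1 * w‖ := by
  by_contra! h
  have h0 : x.1 - x.2.2 * w ≠ 0 := by
    intro h0
    rw [norm_sub_rev (x.2.2 * w), h0, norm_zero] at h
    exact absurd h (not_lt.2 (norm_nonneg _))
  refine hx ((1 - x.2.1 * w) / (x.1 - x.2.2 * w)) w ?_ hw ?_
  · rw [norm_div, norm_sub_rev x.1]
    exact div_le_one_of_le₀ h.le (norm_nonneg _)
  · linear_combination -div_mul_cancel₀ (1 - x.2.1 * w) h0

theorem norm_mul_lt_one {b w : ℂ} (hb : ‖b‖ < 1) (hw : ‖w‖ ≤ 1) : ‖b * w‖ < 1 := by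
  rw [norm_mul]
  nlinarith [norm_nonneg b, norm_nonneg w]

theorem one_sub_ne_zero_of_norm_lt {u : ℂ} (hu : ‖u‖ < 1) : 1 - u ≠ 0 := by
  intro h
  rw [← sub_eq_zero.1 h] at hu
  simp at hu

theorem exists_unit_mul_eq_norm (x : ℂ) : ∃ u : ℂ, ‖u‖ = 1 ∧ x * u = ‖x‖ := by
  rcases eq_or_ne x 0 with rfl | hx
  · exact ⟨1, by simp, by simp⟩
  · have hx' : (‖x‖ : ℂ) ≠ 0 := by simpa using hx
    refine ⟨conj x / ‖x‖, by simp [hx], ?_⟩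
    rw [← mul_div_assoc, Complex.mul_conj']
    field_simp

theorem exists_unit_norm_add (x y : ℂ) : ∃ u : ℂ, ‖u‖ = 1 ∧ ‖x + y * u‖ = ‖x‖ + ‖y‖ := by
  obtain ⟨v, hv, hxv⟩ := exists_unit_mul_eq_norm x
  obtain ⟨u, hu, hyu⟩ := exists_unit_mul_eq_norm y
  have hv0 : v ≠ 0 := by
    rintro rfl
    simp at hv
  refine ⟨u / v, by simp [hu, hv], ?_⟩
  have h : x + y * (u / v) = ((‖x‖ + ‖y‖ : ℝ) : ℂ) / v := by
    push_cast
    rw [← hxv, ← hyu]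
    field_simp
  rw [h, norm_div, hv, div_one, Complex.norm_real, Real.norm_of_nonneg (by positivity)]

theorem sq_norm_sub_conj_mul (a b p : ℂ) :
    ‖a - conj b * p‖ ^ 2 - ‖a * b - p‖ ^ 2 = (‖a‖ ^ 2 - ‖p‖ ^ 2) * (1 - ‖b‖ ^ 2) := by
  simp only [← Complex.normSq_eq_norm_sq, Complex.normSq_apply, Complex.sub_re, Complex.sub_im,
    Complex.mul_re, Complex.mul_im, Complex.conj_re, Complex.conj_im]
  ring

theorem sq_norm_scaled_sub_conj_mul (r : ℝ) (a b p : ℂ) :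
    r ^ 2 * ‖a - conj b * p‖ ^ 2 - ‖(r : ℂ) ^ 2 * b - conj a * p‖ ^ 2
      = (‖a‖ ^ 2 - r ^ 2 * ‖b‖ ^ 2) * (r ^ 2 - ‖p‖ ^ 2) := by
  simp only [← Complex.normSq_eq_norm_sq, Complex.normSq_apply, Complex.sub_re, Complex.sub_im,
    Complex.mul_re, Complex.mul_im, Complex.conj_re, Complex.conj_im, ← Complex.ofReal_pow,
    Complex.ofReal_re, Complex.ofReal_im]
  ring

theorem norm_sub_conj_le {b w : ℂ} (hb : ‖b‖ < 1) (hw : ‖w‖ ≤ 1) :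
    ‖w - conj b‖ ≤ ‖1 - b * w‖ := by
  have h : ‖1 - b * w‖ ^ 2 - ‖w - conj b‖ ^ 2 = (1 - ‖b‖ ^ 2) * (1 - ‖w‖ ^ 2) := by
    simp only [← Complex.normSq_eq_norm_sq, Complex.normSq_apply, Complex.sub_re, Complex.sub_im,
      Complex.mul_re, Complex.mul_im, Complex.conj_re, Complex.conj_im, Complex.one_re,
      Complex.one_im]
    ring
  have h1 : 0 ≤ (1 - ‖b‖ ^ 2) * (1 - ‖w‖ ^ 2) := by
    apply mul_nonneg <;> nlinarith [norm_nonneg b, norm_nonneg w]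
  exact le_of_sq_le_sq (by linarith) (norm_nonneg _)

/-! ### The scalar inequality and its equivalent forms. -/

section

variable {r : ℝ} {a b p : ℂ}

theorem norm_add_norm_le_of_circle_bound (hb : ‖b‖ < 1)
    (h : ∀ w : ℂ, ‖w‖ = 1 → ‖p * w - a‖ ≤ r * ‖1 - b * w‖) :
    ‖a - conj b * p‖ + ‖a * b - p‖ ≤ r * (1 - ‖b‖ ^ 2) := by
  obtain ⟨u, hu, hsum⟩ := exists_unit_norm_add (a - conj b * p) (a * b - p)
  have h0 : 1 + b * u ≠ 0 := by
    have := one_sub_ne_zero_of_norm_lt (u := -(b * u))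
      (by rw [norm_neg]; exact norm_mul_lt_one hb hu.le)
    simpa using this
  have hn : ‖u + conj b‖ = ‖1 + b * u‖ := by
    have h1 : ‖u‖ ^ 2 = 1 := by rw [hu]; norm_num
    refine (sq_eq_sq₀ (norm_nonneg _) (norm_nonneg _)).1 ?_
    simp only [← Complex.normSq_eq_norm_sq, Complex.normSq_apply, Complex.add_re, Complex.add_im,
      Complex.mul_re, Complex.mul_im, Complex.conj_re, Complex.conj_im, Complex.one_re,
      Complex.one_im] at h1 ⊢
    linear_combination (1 - b.re ^ 2 - b.im ^ 2) * h1
  -- This disc automorphism recentres the image: the fractional map becomes `A + D * u` over the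
  -- constant `1 - ‖b‖ ^ 2`, and `u` was chosen to align the two terms.
  have hw := h ((u + conj b) / (1 + b * u)) (by rw [norm_div, hn, div_self (norm_ne_zero_iff.2 h0)])
  have e1 : p * ((u + conj b) / (1 + b * u)) - a
      = -((a - conj b * p) + (a * b - p) * u) / (1 + b * u) := by
    rw [eq_div_iff h0]
    linear_combination p * div_mul_cancel₀ (u + conj b) h0
  have e2 : 1 - b * ((u + conj b) / (1 + b * u)) = ((1 - ‖b‖ ^ 2 : ℝ) : ℂ) / (1 + b * u) := by
    push_cast
    rw [← Complex.mul_conj']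
    field_simp
    ring
  have hb2 : 0 ≤ 1 - ‖b‖ ^ 2 := by nlinarith [norm_nonneg b]
  rw [e1, e2, norm_div, norm_div, norm_neg, hsum, Complex.norm_real, Real.norm_of_nonneg hb2,
    ← mul_div_assoc] at hw
  exact (div_le_div_iff_of_pos_right (norm_pos_iff.2 h0)).1 hw

theorem disc_bound_of_norm_add_norm_le (hb : ‖b‖ < 1)
    (h : ‖a - conj b * p‖ + ‖a * b - p‖ ≤ r * (1 - ‖b‖ ^ 2)) {w : ℂ} (hw : ‖w‖ ≤ 1) :
    ‖p * w - a‖ ≤ r * ‖1 - b * w‖ := by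
  have e : ((1 - ‖b‖ ^ 2 : ℝ) : ℂ) * (p * w - a)
      = -((a - conj b * p) * (1 - b * w) + (a * b - p) * (w - conj b)) := by
    push_cast
    rw [← Complex.mul_conj']
    ring
  have hb2 : 0 < 1 - ‖b‖ ^ 2 := by nlinarith [norm_nonneg b]
  refine le_of_mul_le_mul_left ?_ hb2
  calc (1 - ‖b‖ ^ 2) * ‖p * w - a‖
      = ‖(a - conj b * p) * (1 - b * w) + (a * b - p) * (w - conj b)‖ := by
        rw [← norm_neg ((a - conj b * p) * _ + _), ← e, norm_mul,
          Complex.norm_real, Real.norm_of_nonneg hb2.le]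
    _ ≤ ‖a - conj b * p‖ * ‖1 - b * w‖ + ‖a * b - p‖ * ‖w - conj b‖ := by
        rw [← norm_mul, ← norm_mul]
        exact norm_add_le _ _
    _ ≤ ‖a - conj b * p‖ * ‖1 - b * w‖ + ‖a * b - p‖ * ‖1 - b * w‖ := by
        gcongr
        exact norm_sub_conj_le hb hw
    _ ≤ (1 - ‖b‖ ^ 2) * (r * ‖1 - b * w‖) := by
        nlinarith [mul_le_mul_of_nonneg_right h (norm_nonneg (1 - b * w))]

theorem sq_norm_difference_on_circle (r : ℝ) (a b p : ℂ) {w : ℂ} (hw : ‖w‖ = 1) :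
    (r * ‖1 - b * w‖) ^ 2 - ‖p * w - a‖ ^ 2 = r ^ 2 + r ^ 2 * ‖b‖ ^ 2 - ‖a‖ ^ 2 - ‖p‖ ^ 2
      - 2 * (((r : ℂ) ^ 2 * b - conj a * p) * w).re := by
  have h1 : ‖w‖ ^ 2 = 1 := by rw [hw]; norm_num
  rw [mul_pow]
  simp only [← Complex.normSq_eq_norm_sq, Complex.normSq_apply, Complex.sub_re, Complex.sub_im,
    Complex.mul_re, Complex.mul_im, Complex.conj_re, Complex.conj_im, ← Complex.ofReal_pow,
    Complex.ofReal_re, Complex.ofReal_im, Complex.one_re, Complex.one_im] at h1 ⊢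
  linear_combination (r ^ 2 * (b.re ^ 2 + b.im ^ 2) - p.re ^ 2 - p.im ^ 2) * h1

/-- On the unit circle the difference of squares is a constant minus the real part of a linear term
in `w`, so its minimum is explicit. -/
theorem circle_bound_iff (hr : 0 ≤ r) :
    (∀ w : ℂ, ‖w‖ = 1 → ‖p * w - a‖ ≤ r * ‖1 - b * w‖) ↔
      ‖a‖ ^ 2 - r ^ 2 * ‖b‖ ^ 2 + ‖p‖ ^ 2 + 2 * ‖(r : ℂ) ^ 2 * b - conj a * p‖ ≤ r ^ 2 := by
  constructor
  · intro h
    obtain ⟨u, hu, hmax⟩ := exists_unit_mul_eq_norm ((r : ℂ) ^ 2 * b - conj a * p)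
    have h1 := sq_norm_difference_on_circle r a b p hu
    rw [hmax, Complex.ofReal_re] at h1
    have h2 := pow_le_pow_left₀ (norm_nonneg _) (h u hu) 2
    linarith
  · intro h w hw
    have h1 := sq_norm_difference_on_circle r a b p hw
    have h2 := Complex.re_le_norm (((r : ℂ) ^ 2 * b - conj a * p) * w)
    rw [norm_mul, hw, mul_one] at h2
    exact le_of_sq_le_sq (by linarith) (by positivity)

theorem norm_le_of_norm_add_norm_le (hb : ‖b‖ < 1)
    (h : ‖a - conj b * p‖ + ‖a * b - p‖ ≤ r * (1 - ‖b‖ ^ 2)) : ‖p‖ ≤ r := by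
  have hb2 : 0 < 1 - ‖b‖ ^ 2 := by nlinarith [norm_nonneg b]
  have e : ((1 - ‖b‖ ^ 2 : ℝ) : ℂ) * p = b * (a - conj b * p) - (a * b - p) := by
    push_cast
    rw [← Complex.mul_conj']
    ring
  have h1 : (1 - ‖b‖ ^ 2) * ‖p‖ ≤ ‖b‖ * ‖a - conj b * p‖ + ‖a * b - p‖ := by
    rw [← Real.norm_of_nonneg hb2.le, ← Complex.norm_real, ← norm_mul, e, ← norm_mul]
    exact norm_sub_le _ _
  nlinarith [norm_nonneg (a - conj b * p)]

/-- Isolate `‖A‖`, square, and cancel `1 - ‖b‖ ^ 2` using `sq_norm_sub_conj_mul`. The bound `‖p‖ ≤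
r` is what allows the square root to be taken on the way back. -/
theorem norm_add_norm_le_iff_area (hb : ‖b‖ < 1) :
    ‖a - conj b * p‖ + ‖a * b - p‖ ≤ r * (1 - ‖b‖ ^ 2) ↔
      ‖p‖ ≤ r ∧ ‖a‖ ^ 2 + (r * ‖b‖) ^ 2 - ‖p‖ ^ 2 + 2 * r * ‖a * b - p‖ ≤ r ^ 2 := by
  have hb2 : 0 < 1 - ‖b‖ ^ 2 := by nlinarith [norm_nonneg b]
  have hid := sq_norm_sub_conj_mul a b p
  have hA := norm_nonneg (a - conj b * p)
  have hD := norm_nonneg (a * b - p)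
  constructor
  · intro h
    refine ⟨norm_le_of_norm_add_norm_le hb h, ?_⟩
    refine le_of_mul_le_mul_right ?_ hb2
    have : ‖a - conj b * p‖ ^ 2 ≤ (r * (1 - ‖b‖ ^ 2) - ‖a * b - p‖) ^ 2 :=
      pow_le_pow_left₀ hA (by linarith) 2
    linear_combination this - hid
  · rintro ⟨hp, h⟩
    have h1 : ‖a - conj b * p‖ ^ 2 ≤ (r * (1 - ‖b‖ ^ 2) - ‖a * b - p‖) ^ 2 := by
      have := mul_le_mul_of_nonneg_right h hb2.le
      linear_combination this + hid
    have e : a * b - p = b * (a - conj b * p) - ((1 - ‖b‖ ^ 2 : ℝ) : ℂ) * p := by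
      push_cast
      rw [← Complex.mul_conj']
      ring
    have h2 : ‖a * b - p‖ ≤ ‖b‖ * ‖a - conj b * p‖ + (1 - ‖b‖ ^ 2) * ‖p‖ := by
      conv_lhs => rw [e]
      refine (norm_sub_le _ _).trans_eq ?_
      rw [norm_mul, norm_mul, Complex.norm_real, Real.norm_of_nonneg hb2.le]
    have h3 : (1 - ‖b‖ ^ 2) * ‖p‖ ≤ (1 - ‖b‖ ^ 2) * r := by gcongr
    rcases abs_le_of_sq_le_sq' (a := ‖a - conj b * p‖)
      (b := |r * (1 - ‖b‖ ^ 2) - ‖a * b - p‖|) (by rwa [sq_abs]) (abs_nonneg _) with ⟨-, h4⟩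
    rcases abs_cases (r * (1 - ‖b‖ ^ 2) - ‖a * b - p‖) with ⟨h5, -⟩ | ⟨h5, h6⟩
    · linarith
    · rw [h5] at h4
      -- If `‖D‖` exceeded `r * (1 - ‖b‖ ^ 2)`, then `h2` and `h3` would force `A = 0`, and they
      -- then bound `‖D‖` itself.
      have h7 : ‖a - conj b * p‖ * (1 - ‖b‖) ≤ 0 := by linarith
      have h8 : ‖a - conj b * p‖ ≤ 0 := by
        by_contra! h8
        nlinarith
      nlinarith [norm_nonneg b]

theorem symmetric_sum_le_iff (hr : 0 < r) (hb : ‖b‖ < 1) :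
    ‖a - conj b * p‖ + ‖a * b - p‖ ≤ r * (1 - ‖b‖ ^ 2) ↔
      r * ‖a - conj b * p‖ + ‖(r : ℂ) ^ 2 * b - conj a * p‖ + ‖p‖ ^ 2 ≤ r ^ 2 := by
  have hb2 : 0 < 1 - ‖b‖ ^ 2 := by nlinarith [norm_nonneg b]
  have hA := norm_nonneg (a - conj b * p)
  have hD := norm_nonneg (a * b - p)
  have hB := norm_nonneg ((r : ℂ) ^ 2 * b - conj a * p)
  constructor
  · intro h
    have h6 := (circle_bound_iff hr.le).1 fun w hw => disc_bound_of_norm_add_norm_le hb h hw.le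
    have hid := sq_norm_sub_conj_mul a b p
    -- Isolating `‖D‖` instead of `‖A‖` gives a companion of `h6`; half the sum of the two is the
    -- claim.
    have h1 : r ^ 2 * ‖b‖ ^ 2 - ‖a‖ ^ 2 + ‖p‖ ^ 2 + 2 * r * ‖a - conj b * p‖ ≤ r ^ 2 := by
      refine le_of_mul_le_mul_right ?_ hb2
      have : ‖a * b - p‖ ^ 2 ≤ (r * (1 - ‖b‖ ^ 2) - ‖a - conj b * p‖) ^ 2 :=
        pow_le_pow_left₀ hD (by linarith) 2
      linear_combination this + hid
    linarith
  · intro h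
    refine norm_add_norm_le_of_circle_bound hb ((circle_bound_iff hr.le).2 ?_)
    have hid := sq_norm_scaled_sub_conj_mul r a b p
    have hrA := mul_nonneg hr.le hA
    have hc : 0 ≤ r ^ 2 - ‖p‖ ^ 2 := by linarith
    have h1 : (r * ‖a - conj b * p‖) ^ 2
        ≤ (r ^ 2 - ‖p‖ ^ 2 - ‖(r : ℂ) ^ 2 * b - conj a * p‖) ^ 2 :=
      pow_le_pow_left₀ hrA (by linarith) 2
    -- The factor `r ^ 2 - ‖p‖ ^ 2` is to be cancelled; when it is zero, both norms in `h` vanish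
    -- and the claim is checked directly.
    rcases hc.eq_or_lt with hc0 | hc0
    · have hA0 : a - conj b * p = 0 := by
        rw [← norm_eq_zero]
        nlinarith
      have ha : ‖a‖ ^ 2 = ‖b‖ ^ 2 * ‖p‖ ^ 2 := by
        rw [sub_eq_zero.1 hA0, norm_mul, RCLike.norm_conj, mul_pow]
      have : ‖b‖ ^ 2 * ‖p‖ ^ 2 = r ^ 2 * ‖b‖ ^ 2 := by
        rw [← sub_eq_zero.1 hc0.symm, mul_comm]
      linarith
    · refine le_of_mul_le_mul_right ?_ hc0
      linear_combination h1 - hid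

/-- Together with their conjugates, the two equations form a linear system for the β's. Its solution
is `conj l * (a - conj b * p)` and `‖l‖ ^ 2 * b - conj a * p`, each over `‖l‖ ^ 2 - ‖p‖ ^ 2`, so the
sum bound on the β's is the inequality. -/
theorem symmetric_sum_le_iff_exists {l : ℂ} (hl : l ≠ 0) (hb : ‖b‖ < 1) :
    ‖l‖ * ‖a - conj b * p‖ + ‖(‖l‖ : ℂ) ^ 2 * b - conj a * p‖ + ‖p‖ ^ 2 ≤ ‖l‖ ^ 2 ↔
      ‖p‖ ≤ ‖l‖ ∧ ∃ β₁ β₂ : ℂ, ‖β₁‖ + ‖β₂‖ ≤ 1 ∧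
          a = β₁ * l + conj β₂ * p ∧ b * l = β₂ * l + conj β₁ * p := by
  have hl' : 0 < ‖l‖ := norm_pos_iff.2 hl
  have hA := norm_nonneg (a - conj b * p)
  have hB := norm_nonneg ((‖l‖ : ℂ) ^ 2 * b - conj a * p)
  constructor
  · intro h
    have hp : ‖p‖ ≤ ‖l‖ := le_of_sq_le_sq (by nlinarith) (norm_nonneg _)
    refine ⟨hp, ?_⟩
    have hc : 0 ≤ ‖l‖ ^ 2 - ‖p‖ ^ 2 := by nlinarith
    rcases hc.eq_or_lt with hc0 | hc0
    · have hA0 : a - conj b * p = 0 := by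
        rw [← norm_eq_zero]
        nlinarith
      -- In the singular case `‖p‖ = ‖l‖` the system is consistent because `a = conj b * p`.
      exact ⟨0, b, by simpa using hb.le, by simpa using sub_eq_zero.1 hA0, by simp⟩
    · have hcc : l * conj l - p * conj p ≠ 0 := by
        rw [Complex.mul_conj', Complex.mul_conj']
        exact_mod_cast hc0.ne'
      have hn : ‖l * conj l - p * conj p‖ = ‖l‖ ^ 2 - ‖p‖ ^ 2 := by
        rw [Complex.mul_conj', Complex.mul_conj', ← Complex.ofReal_pow, ← Complex.ofReal_pow,
          ← Complex.ofReal_sub, Complex.norm_real, Real.norm_of_nonneg hc]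
      refine ⟨conj l * (a - conj b * p) / (l * conj l - p * conj p),
        ((‖l‖ : ℂ) ^ 2 * b - conj a * p) / (l * conj l - p * conj p), ?_, ?_, ?_⟩
      · rw [norm_div, norm_div, hn, ← add_div, norm_mul, RCLike.norm_conj]
        exact div_le_one_of_le₀ (by linarith) hc
      · rw [← Complex.mul_conj']
        simp only [map_div₀, map_sub, map_mul, Complex.conj_conj]
        rw [mul_comm (conj l) l, mul_comm (conj p) p, div_mul_eq_mul_div, div_mul_eq_mul_div,
          ← add_div, eq_div_iff hcc]
        ring
      · rw [← Complex.mul_conj']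
        simp only [map_div₀, map_sub, map_mul, Complex.conj_conj]
        rw [mul_comm (conj l) l, mul_comm (conj p) p, div_mul_eq_mul_div, div_mul_eq_mul_div,
          ← add_div, eq_div_iff hcc]
        ring
  · rintro ⟨hp, β₁, β₂, hβ, ha, hb'⟩
    have hc : 0 ≤ ‖l‖ ^ 2 - ‖p‖ ^ 2 := by nlinarith [norm_nonneg p]
    have hn : ‖l * conj l - p * conj p‖ = ‖l‖ ^ 2 - ‖p‖ ^ 2 := by
      rw [Complex.mul_conj', Complex.mul_conj', ← Complex.ofReal_pow, ← Complex.ofReal_pow,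
        ← Complex.ofReal_sub, Complex.norm_real, Real.norm_of_nonneg hc]
    have hbc : conj b * conj l = conj β₂ * conj l + β₁ * conj p := by
      have := congrArg conj hb'
      simpa using this
    have hac : conj a = conj β₁ * conj l + β₂ * conj p := by
      have := congrArg conj ha
      simpa using this
    have e1 : conj l * (a - conj b * p) = β₁ * (l * conj l - p * conj p) := by
      linear_combination conj l * ha - p * hbc
    have e2 : (‖l‖ : ℂ) ^ 2 * b - conj a * p = β₂ * (l * conj l - p * conj p) := by
      rw [← Complex.mul_conj']
      linear_combination conj l * hb' - p * hac
    have n1 := congrArg norm e1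
    have n2 := congrArg norm e2
    rw [norm_mul, norm_mul, RCLike.norm_conj, hn] at n1
    rw [norm_mul, hn] at n2
    nlinarith [norm_nonneg β₁, norm_nonneg β₂]

theorem closed_disc_bound_of_open_disc_bound
    (h : ∀ w ∈ unitDisc, ‖p * w - a‖ ≤ r * ‖1 - b * w‖) {w : ℂ} (hw : ‖w‖ ≤ 1) :
    ‖p * w - a‖ ≤ r * ‖1 - b * w‖ := by
  have hcl : IsClosed {w : ℂ | ‖p * w - a‖ ≤ r * ‖1 - b * w‖} :=
    isClosed_le (by fun_prop) (by fun_prop)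
  have hsub : closure unitDisc ⊆ {w : ℂ | ‖p * w - a‖ ≤ r * ‖1 - b * w‖} :=
    closure_minimal h hcl
  rw [closure_ball (0 : ℂ) one_ne_zero] at hsub
  exact hsub (by simpa using hw)

theorem norm_add_norm_le_iff_disc_bound (hb : ‖b‖ < 1) :
    ‖a - conj b * p‖ + ‖a * b - p‖ ≤ r * (1 - ‖b‖ ^ 2) ↔
      ∀ w ∈ unitDisc, ‖p * w - a‖ ≤ r * ‖1 - b * w‖ :=
  ⟨fun h _ hw => disc_bound_of_norm_add_norm_le hb h (mem_ball_zero_iff.1 hw).le,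
    fun h => norm_add_norm_le_of_circle_bound hb fun _ hw =>
      closed_disc_bound_of_open_disc_bound h hw.le⟩

theorem norm_add_norm_le_iff_circle_bound (hb : ‖b‖ < 1) :
    ‖a - conj b * p‖ + ‖a * b - p‖ ≤ r * (1 - ‖b‖ ^ 2) ↔
      ∀ w : ℂ, ‖w‖ = 1 → ‖p * w - a‖ ≤ r * ‖1 - b * w‖ :=
  ⟨fun h _ hw => disc_bound_of_norm_add_norm_le hb h hw.le, norm_add_norm_le_of_circle_bound hb⟩

theorem hInftyNorm_tetraPsi_le_iff {l : ℂ} (hb : ‖b‖ < 1) :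
    hInftyNorm (fun z => tetraPsi z (a, b, p)) ≤ ‖l‖ₑ ↔
      ∀ w ∈ unitDisc, ‖p * w - a‖ ≤ ‖l‖ * ‖1 - b * w‖ := by
  unfold hInftyNorm
  rw [iSup₂_le_iff]
  refine forall₂_congr fun z hz => ?_
  have hz1 : ‖z‖ ≤ 1 := (mem_ball_zero_iff.1 hz).le
  have h0 : 1 - b * z ≠ 0 := one_sub_ne_zero_of_norm_lt (norm_mul_lt_one hb hz1)
  have h1 : b * z - 1 ≠ 0 := fun h => h0 (by linear_combination -h)
  have e : tetraPsi z (a, b, p) * (1 - b * z) = -(p * z - a) := by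
    unfold tetraPsi
    split_ifs with h
    · simp only at h ⊢
      rw [← h]
      ring
    · linear_combination -div_mul_cancel₀ (p * z - a) h1
  rw [enorm_le_iff_norm_le, ← norm_neg (p * z - a), ← e, norm_mul]
  exact (mul_le_mul_iff_left₀ (norm_pos_iff.2 h0)).symm

/-- The polynomial is affine in `z`; its root `l * (1 - b * w) / (a - p * w)` avoids the open disc
exactly when the bound holds at `w`. -/
theorem forall_ne_zero_iff_disc_bound {l : ℂ} (hl : l ≠ 0) (hb : ‖b‖ < 1) :
    (∀ z ∈ unitDisc, ∀ w ∈ unitDisc, l - a * z - b * l * w + p * z * w ≠ 0) ↔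
      ∀ w ∈ unitDisc, ‖p * w - a‖ ≤ ‖l‖ * ‖1 - b * w‖ := by
  constructor
  · intro h w hw
    by_contra! hlt
    have h0 : a - p * w ≠ 0 := by
      intro h0
      rw [norm_sub_rev (p * w), h0, norm_zero] at hlt
      exact absurd hlt (not_lt.2 (by positivity))
    refine h (l * (1 - b * w) / (a - p * w)) ?_ w hw ?_
    · rw [mem_ball_zero_iff, norm_div, norm_mul, norm_sub_rev a,
        div_lt_one ((by positivity : 0 ≤ ‖l‖ * ‖1 - b * w‖).trans_lt hlt)]
      exact hlt
    · linear_combination -div_mul_cancel₀ (l * (1 - b * w)) h0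
  · intro h z hz w hw h0
    rw [mem_ball_zero_iff] at hz
    have hw1 : ‖w‖ ≤ 1 := (mem_ball_zero_iff.1 hw).le
    have h1 : 1 - b * w ≠ 0 := one_sub_ne_zero_of_norm_lt (norm_mul_lt_one hb hw1)
    have hpos : 0 < ‖l‖ * ‖1 - b * w‖ := mul_pos (norm_pos_iff.2 hl) (norm_pos_iff.2 h1)
    have e : l * (1 - b * w) = -(z * (p * w - a)) := by linear_combination h0
    have n := congrArg norm e
    rw [norm_neg, norm_mul, norm_mul] at n
    have := h w hw
    nlinarith [norm_nonneg z]

end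

/-! ### Contractions of size two. -/

theorem norm_toEuclideanCLM_le_one_iff (M : Matrix (Fin 2) (Fin 2) ℂ) :
    ‖Matrix.toEuclideanCLM (n := Fin 2) (𝕜 := ℂ) M‖ ≤ 1 ↔
      ∀ x y : ℂ, ‖M 0 0 * x + M 0 1 * y‖ ^ 2 + ‖M 1 0 * x + M 1 1 * y‖ ^ 2
        ≤ ‖x‖ ^ 2 + ‖y‖ ^ 2 := by
  constructor
  · intro h x y
    have h1 := (Matrix.toEuclideanCLM (n := Fin 2) (𝕜 := ℂ) M).le_of_opNorm_le h
      (WithLp.toLp 2 ![x, y])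
    have h2 := pow_le_pow_left₀ (norm_nonneg _) h1 2
    rw [one_mul, EuclideanSpace.norm_sq_eq, EuclideanSpace.norm_sq_eq] at h2
    simpa [Matrix.toEuclideanCLM_toLp, Fin.sum_univ_two, Matrix.mulVec, dotProduct] using h2
  · intro h
    refine ContinuousLinearMap.opNorm_le_bound _ zero_le_one fun v => ?_
    rw [one_mul]
    refine le_of_sq_le_sq ?_ (norm_nonneg _)
    rw [EuclideanSpace.norm_sq_eq, EuclideanSpace.norm_sq_eq]
    simpa [Matrix.ofLp_toEuclideanCLM, Fin.sum_univ_two, Matrix.mulVec, dotProduct]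
      using h (v 0) (v 1)

/-- With `M` the matrix of the `mᵢ`, `P` and `R` are the diagonal entries of `1 - M* M` and `q` is,
up to sign and conjugation, the off-diagonal one. The hypotheses make its determinant and trace
nonnegative, so it is positive semidefinite. -/
theorem sq_norm_mulVec_le_of_frobenius_le {m₁ m₂ m₃ m₄ : ℂ}
    (hF : ‖m₁‖ ^ 2 + ‖m₂‖ ^ 2 + ‖m₃‖ ^ 2 + ‖m₄‖ ^ 2 ≤ 1 + ‖m₁ * m₄ - m₂ * m₃‖ ^ 2)
    (hdet : ‖m₁ * m₄ - m₂ * m₃‖ ≤ 1) (x y : ℂ) :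
    ‖m₁ * x + m₂ * y‖ ^ 2 + ‖m₃ * x + m₄ * y‖ ^ 2 ≤ ‖x‖ ^ 2 + ‖y‖ ^ 2 := by
  set P := 1 - ‖m₁‖ ^ 2 - ‖m₃‖ ^ 2 with hP
  set R := 1 - ‖m₂‖ ^ 2 - ‖m₄‖ ^ 2 with hR
  set q := m₁ * conj m₂ + m₃ * conj m₄ with hq
  have hPR : P * R - ‖q‖ ^ 2 = 1 + ‖m₁ * m₄ - m₂ * m₃‖ ^ 2
      - (‖m₁‖ ^ 2 + ‖m₂‖ ^ 2 + ‖m₃‖ ^ 2 + ‖m₄‖ ^ 2) := by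
    rw [hP, hR, hq]
    simp only [← Complex.normSq_eq_norm_sq, Complex.normSq_apply, Complex.sub_re, Complex.sub_im,
      Complex.add_re, Complex.add_im, Complex.mul_re, Complex.mul_im, Complex.conj_re,
      Complex.conj_im]
    ring
  have hexp : ‖m₁ * x + m₂ * y‖ ^ 2 + ‖m₃ * x + m₄ * y‖ ^ 2
      = (1 - P) * ‖x‖ ^ 2 + (1 - R) * ‖y‖ ^ 2 + 2 * (q * (x * conj y)).re := by
    rw [hP, hR, hq]
    simp only [← Complex.normSq_eq_norm_sq, Complex.normSq_apply,
      Complex.add_re, Complex.add_im, Complex.mul_re, Complex.mul_im, Complex.conj_re,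
      Complex.conj_im]
    ring
  have hdet2 : ‖m₁ * m₄ - m₂ * m₃‖ ^ 2 ≤ 1 := pow_le_one₀ (norm_nonneg _) hdet
  have hq2 : ‖q‖ ^ 2 ≤ P * R := by linarith
  have hsum : 0 ≤ P + R := by linarith
  have hP0 : 0 ≤ P := by
    by_contra! h
    nlinarith [sq_nonneg ‖q‖]
  have hR0 : 0 ≤ R := by
    by_contra! h
    nlinarith [sq_nonneg ‖q‖]
  have hq3 : ‖q‖ ≤ √P * √R := by
    rw [← Real.sqrt_mul hP0]
    exact Real.le_sqrt_of_sq_le hq2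
  have hre : (q * (x * conj y)).re ≤ ‖q‖ * (‖x‖ * ‖y‖) := by
    refine (Complex.re_le_norm _).trans_eq ?_
    rw [norm_mul, norm_mul, RCLike.norm_conj]
  have h1 : ‖q‖ * (‖x‖ * ‖y‖) ≤ √P * √R * (‖x‖ * ‖y‖) := by gcongr
  have h2 := sq_nonneg (√P * ‖x‖ - √R * ‖y‖)
  rw [sub_sq, mul_pow, mul_pow, Real.sq_sqrt hP0, Real.sq_sqrt hR0] at h2
  rw [hexp]
  linarith

theorem norm_sub_det_mul_le_of_contraction {m₁ m₂ m₃ m₄ : ℂ}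
    (h : ∀ x y : ℂ, ‖m₁ * x + m₂ * y‖ ^ 2 + ‖m₃ * x + m₄ * y‖ ^ 2 ≤ ‖x‖ ^ 2 + ‖y‖ ^ 2)
    {w : ℂ} (hw : ‖w‖ ≤ 1) : ‖(m₁ * m₄ - m₂ * m₃) * w - m₁‖ ≤ ‖1 - m₄ * w‖ := by
  -- On this vector both sides acquire a second coordinate proportional to `m₃`, which drops out
  -- since `‖w‖ ≤ 1`.
  have h1 := h (1 - m₄ * w) (w * m₃)
  have e1 : m₁ * (1 - m₄ * w) + m₂ * (w * m₃) = -((m₁ * m₄ - m₂ * m₃) * w - m₁) := by ring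
  have e2 : m₃ * (1 - m₄ * w) + m₄ * (w * m₃) = m₃ := by ring
  rw [e1, e2, norm_neg, norm_mul] at h1
  refine le_of_sq_le_sq ?_ (norm_nonneg _)
  have : ‖w‖ * ‖m₃‖ ≤ ‖m₃‖ := mul_le_of_le_one_left (norm_nonneg _) hw
  have := pow_le_pow_left₀ (by positivity) this 2
  linarith

/-! ### Consequences of the Schwarz lemma. -/

theorem norm_le_norm_of_analyticOnNhd_unitDisc {f : ℂ → ℂ} (hf : AnalyticOnNhd ℂ f unitDisc)
    (hb : ∀ z ∈ unitDisc, ‖f z‖ ≤ 1) (h0 : f 0 = 0) {z : ℂ} (hz : z ∈ unitDisc) :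
    ‖f z‖ ≤ ‖z‖ :=
  Complex.norm_le_norm_of_mapsTo_ball hf.differentiableOn
    (fun w hw => mem_closedBall_zero_iff.2 (hb w hw)) h0 (mem_ball_zero_iff.1 hz)

theorem norm_sub_le_norm_mul_of_analyticOnNhd {x₁ x₂ x₃ : ℂ → ℂ}
    (h₁ : AnalyticOnNhd ℂ x₁ unitDisc) (h₂ : AnalyticOnNhd ℂ x₂ unitDisc)
    (h₃ : AnalyticOnNhd ℂ x₃ unitDisc) (h01 : x₁ 0 = 0) (h02 : x₂ 0 = 0) (h03 : x₃ 0 = 0)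
    (hb : ∀ z ∈ unitDisc, ‖x₂ z‖ ≤ 1) {w : ℂ} (hw : ‖w‖ ≤ 1)
    (hle : ∀ z ∈ unitDisc, ‖x₃ z * w - x₁ z‖ ≤ ‖1 - x₂ z * w‖) {z : ℂ} (hz : z ∈ unitDisc) :
    ‖x₃ z * w - x₁ z‖ ≤ ‖z‖ * ‖1 - x₂ z * w‖ := by
  have hne : ∀ z ∈ unitDisc, 1 - x₂ z * w ≠ 0 := fun z hz =>
    one_sub_ne_zero_of_norm_lt <| norm_mul_lt_one
      ((norm_le_norm_of_analyticOnNhd_unitDisc h₂ hb h02 hz).trans_lt (mem_ball_zero_iff.1 hz)) hw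
  have hden : AnalyticOnNhd ℂ (fun z => 1 - x₂ z * w) unitDisc :=
    analyticOnNhd_const.sub (h₂.mul analyticOnNhd_const)
  have hf : AnalyticOnNhd ℂ (fun z => (x₃ z * w - x₁ z) / (1 - x₂ z * w)) unitDisc :=
    ((h₃.mul analyticOnNhd_const).sub h₁).div hden hne
  have := norm_le_norm_of_analyticOnNhd_unitDisc hf (fun z hz => by
    rw [norm_div]
    exact div_le_one_of_le₀ (hle z hz) (norm_nonneg _)) (by simp [h01, h03]) hz
  rwa [norm_div, div_le_iff₀ (norm_pos_iff.2 (hne z hz))] at this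

theorem norm_le_of_mem_closure_tetrablock {x : ℂ × ℂ × ℂ} (hx : x ∈ closure tetrablock) {w : ℂ}
    (hw : ‖w‖ ≤ 1) : ‖x.1‖ ≤ 1 ∧ ‖x.2.1‖ ≤ 1 ∧ ‖x.2.2 * w - x.1‖ ≤ ‖1 - x.2.1 * w‖ ∧
      ‖x.2.2 * w - x.2.1‖ ≤ ‖1 - x.1 * w‖ := by
  refine ⟨?_, ?_, ?_, ?_⟩
  · exact closure_minimal (t := {x : ℂ × ℂ × ℂ | ‖x.1‖ ≤ 1})
      (fun y hy => (norm_lt_one_of_mem_tetrablock hy).1.le)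
      (isClosed_le (by fun_prop) (by fun_prop)) hx
  · exact closure_minimal (t := {x : ℂ × ℂ × ℂ | ‖x.2.1‖ ≤ 1})
      (fun y hy => (norm_lt_one_of_mem_tetrablock hy).2.le)
      (isClosed_le (by fun_prop) (by fun_prop)) hx
  · exact closure_minimal (t := {x : ℂ × ℂ × ℂ | ‖x.2.2 * w - x.1‖ ≤ ‖1 - x.2.1 * w‖})
      (fun y hy => norm_sub_le_of_mem_tetrablock hy hw)
      (isClosed_le (by fun_prop) (by fun_prop)) hx
  · exact closure_minimal (t := {x : ℂ × ℂ × ℂ | ‖x.2.2 * w - x.2.1‖ ≤ ‖1 - x.1 * w‖})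
      (fun y hy => norm_sub_le_of_mem_tetrablock (swap_mem_tetrablock hy) hw)
      (isClosed_le (by fun_prop) (by fun_prop)) hx

theorem disc_bound_of_exists_map_to_closure {l a b p : ℂ} (hl : l ∈ unitDisc)
    (h : ∃ φ : ℂ → ℂ × ℂ × ℂ, AnalyticOnNhd ℂ φ unitDisc ∧
        Set.MapsTo φ unitDisc (closure tetrablock) ∧ φ 0 = (0, 0, 0) ∧ φ l = (a, b, p))
    {w : ℂ} (hw : ‖w‖ ≤ 1) :
    ‖p * w - a‖ ≤ ‖l‖ * ‖1 - b * w‖ ∧ ‖p * w - b‖ ≤ ‖l‖ * ‖1 - a * w‖ := by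
  obtain ⟨φ, hφ, hmap, h0, hφl⟩ := h
  have h₁ : AnalyticOnNhd ℂ (fun z => (φ z).1) unitDisc := fun z hz =>
    analyticAt_fst.comp (hφ z hz)
  have h₂ : AnalyticOnNhd ℂ (fun z => (φ z).2.1) unitDisc := fun z hz =>
    (analyticAt_fst.comp analyticAt_snd).comp (hφ z hz)
  have h₃ : AnalyticOnNhd ℂ (fun z => (φ z).2.2) unitDisc := fun z hz =>
    (analyticAt_snd.comp analyticAt_snd).comp (hφ z hz)
  have hK := fun z (hz : z ∈ unitDisc) => norm_le_of_mem_closure_tetrablock (hmap hz) hw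
  constructor
  · simpa [hφl] using norm_sub_le_norm_mul_of_analyticOnNhd h₁ h₂ h₃ (by simp [h0]) (by simp [h0])
      (by simp [h0]) (fun z hz => (hK z hz).2.1) hw (fun z hz => (hK z hz).2.2.1) hl
  · simpa [hφl] using norm_sub_le_norm_mul_of_analyticOnNhd h₂ h₁ h₃ (by simp [h0]) (by simp [h0])
      (by simp [h0]) (fun z hz => (hK z hz).1) hw (fun z hz => (hK z hz).2.2.2) hl

theorem exists_map_to_tetrablock_of_schur {l a b p : ℂ}
    (h : ∃ F : ℂ → Matrix (Fin 2) (Fin 2) ℂ, IsSchurClass F ∧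
        (∃ c : ℂ, F 0 = !![0, c; 0, 0]) ∧ (a, b, p) = (F l 0 0, F l 1 1, (F l).det)) :
    ∃ φ : ℂ → ℂ × ℂ × ℂ, AnalyticOnNhd ℂ φ unitDisc ∧
        Set.MapsTo φ unitDisc tetrablock ∧ φ 0 = (0, 0, 0) ∧ φ l = (a, b, p) := by
  obtain ⟨F, ⟨hF, hle⟩, ⟨c, h0⟩, hFl⟩ := h
  have hdet : AnalyticOnNhd ℂ (fun z => F z 0 0 * F z 1 1 - F z 0 1 * F z 1 0) unitDisc :=
    ((hF 0 0).mul (hF 1 1)).sub ((hF 0 1).mul (hF 1 0))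
  have hcon := fun z (hz : z ∈ unitDisc) => (norm_toEuclideanCLM_le_one_iff _).1 (hle z hz)
  refine ⟨fun z => (F z 0 0, F z 1 1, F z 0 0 * F z 1 1 - F z 0 1 * F z 1 0),
    (hF 0 0).prod ((hF 1 1).prod hdet), ?_, by simp [h0], by rw [hFl, Matrix.det_fin_two]⟩
  intro ζ hζ z w hz hw hzero
  simp only at hzero
  have hb : ∀ z ∈ unitDisc, ‖F z 1 1‖ ≤ 1 := by
    intro z hz
    have := hcon z hz 0 1
    refine le_of_sq_le_sq ?_ zero_le_one
    simp only [mul_zero, zero_add, mul_one, norm_zero, norm_one] at this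
    nlinarith [sq_nonneg ‖F z 0 1‖]
  have h1 := norm_sub_le_norm_mul_of_analyticOnNhd (hF 0 0) (hF 1 1) hdet (by simp [h0])
    (by simp [h0]) (by simp [h0]) hb hw
    (fun z hz => norm_sub_det_mul_le_of_contraction (hcon z hz) hw) hζ
  have hζ1 := mem_ball_zero_iff.1 hζ
  have h2 : ‖F ζ 1 1‖ ≤ ‖ζ‖ :=
    norm_le_norm_of_analyticOnNhd_unitDisc (hF 1 1) hb (by simp [h0]) hζ
  have h3 := norm_pos_iff.2 <| one_sub_ne_zero_of_norm_lt (norm_mul_lt_one (h2.trans_lt hζ1) hw)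
  have e : 1 - F ζ 1 1 * w
      = -(z * ((F ζ 0 0 * F ζ 1 1 - F ζ 0 1 * F ζ 1 0) * w - F ζ 0 0)) := by
    linear_combination hzero
  have n := congrArg norm e
  rw [norm_neg, norm_mul] at n
  have h4 := mul_le_of_le_one_left
    (norm_nonneg ((F ζ 0 0 * F ζ 1 1 - F ζ 0 1 * F ζ 1 0) * w - F ζ 0 0)) hz
  -- A zero would give `‖1 - x₂ w‖ ≤ ‖ζ‖ * ‖1 - x₂ w‖` with `x₂ = F ζ 1 1`, impossible since `‖ζ‖ <
  -- 1`; the Schwarz factor is what places the image in the open set.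
  nlinarith

/-! ### Construction of the interpolating Schur function. -/

/-- This supplies the off-diagonal entries: `‖f‖ ^ 2` is taken to be a root of `t ^ 2 - S * t + ‖q‖
^ 2`. -/
theorem exists_mul_eq_of_two_mul_norm_le {q : ℂ} {S : ℝ} (h : 2 * ‖q‖ ≤ S) :
    ∃ f g : ℂ, f * g = q ∧ ‖f‖ ^ 2 + ‖g‖ ^ 2 = S := by
  have hq := norm_nonneg q
  rcases eq_or_ne q 0 with rfl | hq0
  · refine ⟨(√S : ℝ), 0, by simp, ?_⟩
    rw [Complex.norm_real, Real.norm_of_nonneg (Real.sqrt_nonneg _), Real.sq_sqrt]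
    · simp
    · simpa using h
  · have hpos := norm_pos_iff.2 hq0
    have hdisc : 0 ≤ S ^ 2 - 4 * ‖q‖ ^ 2 := by nlinarith
    set t := (S + √(S ^ 2 - 4 * ‖q‖ ^ 2)) / 2 with ht
    have ht0 : 0 < t := by
      have := Real.sqrt_nonneg (S ^ 2 - 4 * ‖q‖ ^ 2)
      linarith
    have hquad : t ^ 2 - S * t + ‖q‖ ^ 2 = 0 := by
      rw [ht]
      linear_combination (1 / 4 : ℝ) * Real.sq_sqrt hdisc
    have hs0 : ((√t : ℝ) : ℂ) ≠ 0 := by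
      exact_mod_cast (Real.sqrt_pos.2 ht0).ne'
    refine ⟨(√t : ℝ), q / (√t : ℝ), mul_div_cancel₀ _ hs0, ?_⟩
    rw [norm_div, Complex.norm_real, Real.norm_of_nonneg (Real.sqrt_nonneg _), div_pow,
      Real.sq_sqrt ht0.le]
    field_simp
    linarith

/-- The four entries are those of `Y + m (adj Y)*` for `Y` with rows `(y₁, f)` and `(g, y₂)`. -/
theorem frobenius_add_smul_conj_adjugate (y₁ y₂ f g m : ℂ) :
    ‖y₁ + m * conj y₂‖ ^ 2 + ‖f - m * conj g‖ ^ 2 + ‖g - m * conj f‖ ^ 2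
        + ‖y₂ + m * conj y₁‖ ^ 2
      = (‖y₁‖ ^ 2 + ‖y₂‖ ^ 2 + ‖f‖ ^ 2 + ‖g‖ ^ 2) * (1 + ‖m‖ ^ 2)
        + 4 * (conj m * (y₁ * y₂ - f * g)).re := by
  simp only [← Complex.normSq_eq_norm_sq, Complex.normSq_apply, Complex.sub_re, Complex.sub_im,
    Complex.add_re, Complex.add_im, Complex.mul_re, Complex.mul_im, Complex.conj_re,
    Complex.conj_im]
  ring

theorem det_add_smul_conj_adjugate (y₁ y₂ f g m : ℂ) :
    (y₁ + m * conj y₂) * (y₂ + m * conj y₁) - (f - m * conj g) * (g - m * conj f)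
      = (y₁ * y₂ - f * g) + m * ((‖y₁‖ ^ 2 + ‖y₂‖ ^ 2 + ‖f‖ ^ 2 + ‖g‖ ^ 2 : ℝ) : ℂ)
        + m ^ 2 * conj (y₁ * y₂ - f * g) := by
  push_cast
  simp only [← Complex.mul_conj', map_sub, map_mul]
  ring

theorem norm_add_le_norm_one_add_conj_mul {y m : ℂ} (hy : ‖y‖ ≤ 1) (hm : ‖m‖ < 1) :
    ‖y + m‖ ≤ ‖1 + conj y * m‖ := by
  have h := norm_sub_conj_le (b := -conj m) (by simpa using hm) hy
  rw [← RCLike.norm_conj (1 + conj y * m)]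
  simpa [mul_comm] using h

theorem norm_sub_lt_norm_one_sub_conj_mul {l z : ℂ} (hl : ‖l‖ < 1) (hz : ‖z‖ < 1) :
    ‖l - z‖ < ‖1 - conj l * z‖ := by
  have h : ‖1 - conj l * z‖ ^ 2 - ‖l - z‖ ^ 2 = (1 - ‖l‖ ^ 2) * (1 - ‖z‖ ^ 2) := by
    simp only [← Complex.normSq_eq_norm_sq, Complex.normSq_apply, Complex.sub_re, Complex.sub_im,
      Complex.mul_re, Complex.mul_im, Complex.conj_re, Complex.conj_im, Complex.one_re,
      Complex.one_im]
    ring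
  have h1 : 0 < (1 - ‖l‖ ^ 2) * (1 - ‖z‖ ^ 2) := by
    apply mul_pos <;> nlinarith [norm_nonneg l, norm_nonneg z]
  exact lt_of_pow_lt_pow_left₀ 2 (norm_nonneg _) (by linarith)

/-- A Schur interpolant with prescribed diagonal and determinant at `l`, whose lower right entry
vanishes at the origin. Contractivity is expressed through the Frobenius norm and the
determinant. -/
theorem exists_interpolant {l y₁ y₂ y₃ : ℂ} (hl : l ∈ unitDisc) (hl0 : l ≠ 0) (h₃ : ‖y₃‖ ≤ 1)
    (hle : ‖y₁‖ ^ 2 + ‖y₂‖ ^ 2 - ‖y₃‖ ^ 2 + 2 * ‖y₁ * y₂ - y₃‖ ≤ 1)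
    (h₂₁ : ‖y₂‖ ≤ ‖l‖ * ‖y₁‖) :
    ∃ g₁ g₂ g₃ g₄ : ℂ → ℂ, AnalyticOnNhd ℂ g₁ unitDisc ∧ AnalyticOnNhd ℂ g₂ unitDisc ∧
      AnalyticOnNhd ℂ g₃ unitDisc ∧ AnalyticOnNhd ℂ g₄ unitDisc ∧
      (∀ z ∈ unitDisc, ‖g₁ z‖ ^ 2 + ‖g₂ z‖ ^ 2 + ‖g₃ z‖ ^ 2 + ‖g₄ z‖ ^ 2
        ≤ 1 + ‖g₁ z * g₄ z - g₂ z * g₃ z‖ ^ 2) ∧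
      (∀ z ∈ unitDisc, ‖g₁ z * g₄ z - g₂ z * g₃ z‖ ≤ 1) ∧
      g₄ 0 = 0 ∧ g₁ l = y₁ ∧ g₄ l = y₂ ∧ g₁ l * g₄ l - g₂ l * g₃ l = y₃ := by
  -- The completion `Y` has `‖Y‖_F ^ 2 = 1 + |det Y| ^ 2`, so one singular value is 1. Then `(Y + m
  -- (adj Y)*) / (1 + conj y₃ * m)` keeps singular value 1 and has determinant `(y₃ + m) / (1 + conj
  -- y₃ * m)`, hence is a contraction for `‖m‖ < 1`.
  obtain ⟨f, g, hfg, hS⟩ := exists_mul_eq_of_two_mul_norm_le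
    (q := y₁ * y₂ - y₃) (S := 1 - ‖y₁‖ ^ 2 - ‖y₂‖ ^ 2 + ‖y₃‖ ^ 2) (by linarith)
  have hdetY : y₁ * y₂ - f * g = y₃ := by rw [hfg]; ring
  have hl1 : ‖l‖ < 1 := mem_ball_zero_iff.1 hl
  have hfrobY : ‖y₁‖ ^ 2 + ‖y₂‖ ^ 2 + ‖f‖ ^ 2 + ‖g‖ ^ 2 = 1 + ‖y₃‖ ^ 2 := by linarith
  -- Chosen so that `m 0 = k * l` cancels the lower right entry; `h₂₁` gives `‖k‖ ≤ 1`. If `y₁ = 0`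
  -- then `y₂ = 0`, and division by zero gives the harmless `k = 0`.
  set k : ℂ := -y₂ / (l * conj y₁) with hk
  have hk1 : ‖k‖ ≤ 1 := by
    rw [hk, norm_div, norm_neg, norm_mul, RCLike.norm_conj]
    exact div_le_one_of_le₀ h₂₁ (by positivity)
  have hk2 : k * l * conj y₁ = -y₂ := by
    rcases eq_or_ne y₁ 0 with rfl | h1
    · have : y₂ = 0 := by simpa using h₂₁
      simp [this]
    · rw [mul_assoc, hk, div_mul_cancel₀]
      exact mul_ne_zero hl0 (by simpa using h1)
  set m : ℂ → ℂ := fun z => k * (l - z) / (1 - conj l * z) with hm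
  have hden : ∀ z ∈ unitDisc, 1 - conj l * z ≠ 0 := fun z hz =>
    one_sub_ne_zero_of_norm_lt (norm_mul_lt_one (by simpa using hl1) (mem_ball_zero_iff.1 hz).le)
  have hm1 : ∀ z ∈ unitDisc, ‖m z‖ < 1 := by
    intro z hz
    simp only [hm]
    rw [norm_div, div_lt_one (norm_pos_iff.2 (hden z hz)), norm_mul]
    exact (mul_le_of_le_one_left (norm_nonneg _) hk1).trans_lt
      (norm_sub_lt_norm_one_sub_conj_mul hl1 (mem_ball_zero_iff.1 hz))
  have hman : AnalyticOnNhd ℂ m unitDisc :=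
    (analyticOnNhd_const.mul (analyticOnNhd_const.sub analyticOnNhd_id)).div
      (analyticOnNhd_const.sub (analyticOnNhd_const.mul analyticOnNhd_id)) hden
  have hml : m l = 0 := by simp [hm]
  have hm0 : m 0 = k * l := by simp [hm]
  have hd : ∀ z ∈ unitDisc, 1 + conj y₃ * m z ≠ 0 := by
    intro z hz
    have := one_sub_ne_zero_of_norm_lt (u := -(m z * conj y₃))
      (by rw [norm_neg]; exact norm_mul_lt_one (hm1 z hz) (by simpa using h₃))
    simpa [mul_comm] using this
  have hdan : AnalyticOnNhd ℂ (fun z => 1 + conj y₃ * m z) unitDisc :=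
    analyticOnNhd_const.add (analyticOnNhd_const.mul hman)
  have hdet : ∀ z ∈ unitDisc,
      (y₁ + m z * conj y₂) / (1 + conj y₃ * m z) * ((y₂ + m z * conj y₁) / (1 + conj y₃ * m z))
        - (f - m z * conj g) / (1 + conj y₃ * m z) * ((g - m z * conj f) / (1 + conj y₃ * m z))
      = (y₃ + m z) / (1 + conj y₃ * m z) := by
    intro z hz
    have h := det_add_smul_conj_adjugate y₁ y₂ f g (m z)
    rw [hdetY, hfrobY] at h
    push_cast at h
    rw [← Complex.mul_conj'] at h
    rw [div_mul_div_comm, div_mul_div_comm, ← sub_div, h,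
      div_eq_div_iff (mul_ne_zero (hd z hz) (hd z hz)) (hd z hz)]
    ring
  refine ⟨fun z => (y₁ + m z * conj y₂) / (1 + conj y₃ * m z),
    fun z => (f - m z * conj g) / (1 + conj y₃ * m z),
    fun z => (g - m z * conj f) / (1 + conj y₃ * m z),
    fun z => (y₂ + m z * conj y₁) / (1 + conj y₃ * m z),
    (analyticOnNhd_const.add (hman.mul analyticOnNhd_const)).div hdan hd,
    (analyticOnNhd_const.sub (hman.mul analyticOnNhd_const)).div hdan hd,
    (analyticOnNhd_const.sub (hman.mul analyticOnNhd_const)).div hdan hd,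
    (analyticOnNhd_const.add (hman.mul analyticOnNhd_const)).div hdan hd, ?_, ?_, ?_,
    by simp [hml], by simp [hml], by simp [hml, hdetY]⟩
  · intro z hz
    simp only
    rw [hdet z hz]
    have hpos : 0 < ‖1 + conj y₃ * m z‖ ^ 2 := by
      have := norm_pos_iff.2 (hd z hz)
      positivity
    have h := frobenius_add_smul_conj_adjugate y₁ y₂ f g (m z)
    rw [hdetY, hfrobY] at h
    have h' : (1 + ‖y₃‖ ^ 2) * (1 + ‖m z‖ ^ 2) + 4 * (conj (m z) * y₃).re
        = ‖1 + conj y₃ * m z‖ ^ 2 + ‖y₃ + m z‖ ^ 2 := by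
      simp only [← Complex.normSq_eq_norm_sq, Complex.normSq_apply, Complex.add_re,
        Complex.add_im, Complex.mul_re, Complex.mul_im, Complex.conj_re, Complex.conj_im,
        Complex.one_re, Complex.one_im]
      ring
    simp only [norm_div, div_pow]
    rw [← add_div, ← add_div, ← add_div, h, h', add_div, div_self hpos.ne']
  · intro z hz
    simp only
    rw [hdet z hz, norm_div]
    exact div_le_one_of_le₀ (norm_add_le_norm_one_add_conj_mul h₃ (hm1 z hz)) (norm_nonneg _)
  · simp only [hm0]
    rw [hk2]
    simp

theorem exists_scaled_interpolant {l a b p : ℂ} (hl : l ∈ unitDisc) (hl0 : l ≠ 0)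
    (hb : ‖b‖ < 1) (hba : ‖b‖ ≤ ‖a‖)
    (h : ‖a - conj b * p‖ + ‖a * b - p‖ ≤ ‖l‖ * (1 - ‖b‖ ^ 2)) :
    ∃ g₁ g₂ g₃ g₄ : ℂ → ℂ, AnalyticOnNhd ℂ g₁ unitDisc ∧ AnalyticOnNhd ℂ g₂ unitDisc ∧
      AnalyticOnNhd ℂ g₃ unitDisc ∧ AnalyticOnNhd ℂ g₄ unitDisc ∧
      (∀ z ∈ unitDisc, ‖g₁ z‖ ^ 2 + ‖g₂ z‖ ^ 2 + ‖g₃ z‖ ^ 2 + ‖g₄ z‖ ^ 2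
        ≤ 1 + ‖g₁ z * g₄ z - g₂ z * g₃ z‖ ^ 2) ∧
      (∀ z ∈ unitDisc, ‖g₁ z * g₄ z - g₂ z * g₃ z‖ ≤ 1) ∧
      g₄ 0 = 0 ∧ l * g₁ l = a ∧ g₄ l = b ∧ l * (g₁ l * g₄ l - g₂ l * g₃ l) = p := by
  have hpos := norm_pos_iff.2 hl0
  obtain ⟨hp, hle⟩ := (norm_add_norm_le_iff_area hb).1 h
  obtain ⟨g₁, g₂, g₃, g₄, A₁, A₂, A₃, A₄, hF, hD, h0, e₁, e₄, eD⟩ :=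
    exists_interpolant (y₁ := a / l) (y₂ := b) (y₃ := p / l) hl hl0
      (by rw [norm_div]; exact div_le_one_of_le₀ hp hpos.le)
      (by
        have e : a / l * b - p / l = (a * b - p) / l := by ring
        rw [e, norm_div, norm_div, norm_div]
        refine le_of_mul_le_mul_right ?_ (pow_pos hpos 2)
        refine Eq.trans_le ?_ (hle.trans_eq (one_mul _).symm)
        field_simp)
      (by rwa [norm_div, mul_div_cancel₀ _ hpos.ne'])
  exact ⟨g₁, g₂, g₃, g₄, A₁, A₂, A₃, A₄, hF, hD, h0, by rw [e₁, mul_div_cancel₀ _ hl0], e₄,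
    by rw [eD, mul_div_cancel₀ _ hl0]⟩

theorem exists_schur_of_norm_le {l a b p : ℂ} (hl : l ∈ unitDisc) (hl0 : l ≠ 0)
    (hb : ‖b‖ < 1) (hba : ‖b‖ ≤ ‖a‖)
    (h : ‖a - conj b * p‖ + ‖a * b - p‖ ≤ ‖l‖ * (1 - ‖b‖ ^ 2)) :
    ∃ F : ℂ → Matrix (Fin 2) (Fin 2) ℂ, IsSchurClass F ∧
        (∃ c : ℂ, F 0 = !![0, c; 0, 0]) ∧ (a, b, p) = (F l 0 0, F l 1 1, (F l).det) := by
  obtain ⟨g₁, g₂, g₃, g₄, A₁, A₂, A₃, A₄, hF, hD, h0, e₁, e₄, eD⟩ :=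
    exists_scaled_interpolant hl hl0 hb hba h
  -- Right multiplication by `diag(z, 1)` kills the first column at the origin.
  refine ⟨fun z => !![z * g₁ z, g₂ z; z * g₃ z, g₄ z], ⟨?_, ?_⟩, ⟨g₂ 0, by simp [h0]⟩, ?_⟩
  · intro i j
    fin_cases i <;> fin_cases j
    · exact analyticOnNhd_id.mul A₁
    · exact A₂
    · exact analyticOnNhd_id.mul A₃
    · exact A₄
  · intro z hz
    rw [norm_toEuclideanCLM_le_one_iff]
    intro x y
    have h1 := sq_norm_mulVec_le_of_frobenius_le (hF z hz) (hD z hz) (z * x) y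
    have h2 : ‖z * x‖ ^ 2 ≤ ‖x‖ ^ 2 := by
      refine pow_le_pow_left₀ (norm_nonneg _) ?_ 2
      rw [norm_mul]
      exact mul_le_of_le_one_left (norm_nonneg _) (mem_ball_zero_iff.1 hz).le
    simp only [Matrix.of_apply, Matrix.cons_val', Matrix.cons_val_zero, Matrix.cons_val_one,
      Matrix.cons_val_fin_one]
    rw [mul_comm z (g₁ z), mul_assoc (g₁ z), mul_comm z (g₃ z), mul_assoc (g₃ z)]
    linarith
  · rw [Matrix.det_fin_two]
    simp only [Matrix.of_apply, Matrix.cons_val', Matrix.cons_val_zero, Matrix.cons_val_one,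
      Matrix.cons_val_fin_one, Prod.mk.injEq]
    exact ⟨e₁.symm, e₄.symm, by rw [← eD]; ring⟩

theorem exists_schur_of_norm_le_swap {l a b p : ℂ} (hl : l ∈ unitDisc) (hl0 : l ≠ 0)
    (ha : ‖a‖ < 1) (hab : ‖a‖ ≤ ‖b‖)
    (h : ‖b - conj a * p‖ + ‖b * a - p‖ ≤ ‖l‖ * (1 - ‖a‖ ^ 2)) :
    ∃ F : ℂ → Matrix (Fin 2) (Fin 2) ℂ, IsSchurClass F ∧
        (∃ c : ℂ, F 0 = !![0, c; 0, 0]) ∧ (a, b, p) = (F l 0 0, F l 1 1, (F l).det) := by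
  obtain ⟨g₁, g₂, g₃, g₄, A₁, A₂, A₃, A₄, hF, hD, h0, e₁, e₄, eD⟩ :=
    exists_scaled_interpolant hl hl0 ha hab h
  -- The diagonal is exchanged, and left multiplication by `diag(1, z)` now kills the second row at
  -- the origin.
  refine ⟨fun z => !![g₄ z, g₂ z; z * g₃ z, z * g₁ z], ⟨?_, ?_⟩, ⟨g₂ 0, by simp [h0]⟩, ?_⟩
  · intro i j
    fin_cases i <;> fin_cases j
    · exact A₄
    · exact A₂
    · exact analyticOnNhd_id.mul A₃
    · exact analyticOnNhd_id.mul A₁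
  · intro z hz
    rw [norm_toEuclideanCLM_le_one_iff]
    intro x y
    have h1 := sq_norm_mulVec_le_of_frobenius_le (m₁ := g₄ z) (m₂ := g₂ z) (m₃ := g₃ z)
      (m₄ := g₁ z) (by rw [mul_comm (g₄ z)]; linarith [hF z hz])
      (by rw [mul_comm (g₄ z)]; exact hD z hz) x y
    have h2 : ‖z * (g₃ z * x + g₁ z * y)‖ ^ 2 ≤ ‖g₃ z * x + g₁ z * y‖ ^ 2 := by
      refine pow_le_pow_left₀ (norm_nonneg _) ?_ 2
      rw [norm_mul]
      exact mul_le_of_le_one_left (norm_nonneg _) (mem_ball_zero_iff.1 hz).le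
    simp only [Matrix.of_apply, Matrix.cons_val', Matrix.cons_val_zero, Matrix.cons_val_one,
      Matrix.cons_val_fin_one]
    rw [mul_assoc z, mul_assoc z, ← mul_add]
    linarith
  · rw [Matrix.det_fin_two]
    simp only [Matrix.of_apply, Matrix.cons_val', Matrix.cons_val_zero, Matrix.cons_val_one,
      Matrix.cons_val_fin_one, Prod.mk.injEq]
    exact ⟨e₄.symm, e₁.symm, by rw [← eD]; ring⟩

/-! ### Assembly of the equivalences. -/

theorem theorem1p1 (l : ℂ) (hl : l ∈ unitDisc) (hl0 : l ≠ 0) (a b p : ℂ)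
    (hx : (a, b, p) ∈ tetrablock) :
    List.TFAE [
      ∃ φ : ℂ → ℂ × ℂ × ℂ, AnalyticOnNhd ℂ φ unitDisc ∧
        Set.MapsTo φ unitDisc (closure tetrablock) ∧ φ 0 = (0, 0, 0) ∧ φ l = (a, b, p),
      ∃ φ : ℂ → ℂ × ℂ × ℂ, AnalyticOnNhd ℂ φ unitDisc ∧
        Set.MapsTo φ unitDisc tetrablock ∧ φ 0 = (0, 0, 0) ∧ φ l = (a, b, p),
      max ((‖a - conj b * p‖ + ‖a * b - p‖) / (1 - ‖b‖ ^ 2))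
        ((‖b - conj a * p‖ + ‖a * b - p‖) / (1 - ‖a‖ ^ 2)) ≤ ‖l‖,
      (‖b‖ ≤ ‖a‖ ∧ (‖a - conj b * p‖ + ‖a * b - p‖) / (1 - ‖b‖ ^ 2) ≤ ‖l‖) ∨
        (‖a‖ ≤ ‖b‖ ∧ (‖b - conj a * p‖ + ‖a * b - p‖) / (1 - ‖a‖ ^ 2) ≤ ‖l‖),
      ∃ F : ℂ → Matrix (Fin 2) (Fin 2) ℂ, IsSchurClass F ∧
        (∃ c : ℂ, F 0 = !![0, c; 0, 0]) ∧ (a, b, p) = (F l 0 0, F l 1 1, (F l).det),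
      (‖b‖ ≤ ‖a‖ ∧ hInftyNorm (fun z => tetraPsi z (a, b, p)) ≤ ‖l‖ₑ) ∨
        (‖a‖ ≤ ‖b‖ ∧ hInftyNorm (fun z => tetraUpsilon z (a, b, p)) ≤ ‖l‖ₑ),
      (‖b‖ ≤ ‖a‖ ∧ ‖a‖ ^ 2 - ‖l‖ ^ 2 * ‖b‖ ^ 2 + ‖p‖ ^ 2
          + 2 * ‖(‖l‖ : ℂ) ^ 2 * b - conj a * p‖ ≤ ‖l‖ ^ 2) ∨
        (‖a‖ ≤ ‖b‖ ∧ ‖b‖ ^ 2 - ‖l‖ ^ 2 * ‖a‖ ^ 2 + ‖p‖ ^ 2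
          + 2 * ‖(‖l‖ : ℂ) ^ 2 * a - conj b * p‖ ≤ ‖l‖ ^ 2),
      ((∀ z ∈ unitDisc, ∀ w ∈ unitDisc, l - a * z - b * l * w + p * z * w ≠ 0) ∧ ‖b‖ ≤ ‖a‖) ∨
        ((∀ z ∈ unitDisc, ∀ w ∈ unitDisc, l - a * l * z - b * w + p * z * w ≠ 0) ∧ ‖a‖ ≤ ‖b‖),
      (‖b‖ ≤ ‖a‖ ∧ ‖l‖ * ‖a - conj b * p‖ + ‖(‖l‖ : ℂ) ^ 2 * b - conj a * p‖
          + ‖p‖ ^ 2 ≤ ‖l‖ ^ 2) ∨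
        (‖a‖ ≤ ‖b‖ ∧ ‖l‖ * ‖b - conj a * p‖ + ‖(‖l‖ : ℂ) ^ 2 * a - conj b * p‖
          + ‖p‖ ^ 2 ≤ ‖l‖ ^ 2),
      (‖b‖ ≤ ‖a‖ ∧ ‖p‖ ≤ ‖l‖ ∧
          ‖a‖ ^ 2 + ‖l * b‖ ^ 2 - ‖p‖ ^ 2 + 2 * ‖l‖ * ‖a * b - p‖ ≤ ‖l‖ ^ 2) ∨
        (‖a‖ ≤ ‖b‖ ∧ ‖p‖ ≤ ‖l‖ ∧
          ‖b‖ ^ 2 + ‖l * a‖ ^ 2 - ‖p‖ ^ 2 + 2 * ‖l‖ * ‖a * b - p‖ ≤ ‖l‖ ^ 2),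
      (‖b‖ ≤ ‖a‖ ∧ ‖p‖ ≤ ‖l‖ ∧ ∃ β₁ β₂ : ℂ, ‖β₁‖ + ‖β₂‖ ≤ 1 ∧
          a = β₁ * l + conj β₂ * p ∧ b * l = β₂ * l + conj β₁ * p) ∨
        (‖a‖ ≤ ‖b‖ ∧ ‖p‖ ≤ ‖l‖ ∧ ∃ β₁ β₂ : ℂ, ‖β₁‖ + ‖β₂‖ ≤ 1 ∧
          a * l = β₁ * l + conj β₂ * p ∧ b = β₂ * l + conj β₁ * p)] := by
  obtain ⟨ha, hb⟩ := norm_lt_one_of_mem_tetrablock hx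
  simp only at ha hb
  have hr : 0 < ‖l‖ := norm_pos_iff.2 hl0
  have ha2 : 0 < 1 - ‖a‖ ^ 2 := by nlinarith [norm_nonneg a]
  have hb2 : 0 < 1 - ‖b‖ ^ 2 := by nlinarith [norm_nonneg b]
  tfae_have 2 → 1 := fun ⟨φ, hφ, hmap, h⟩ => ⟨φ, hφ, hmap.mono_right subset_closure, h⟩
  tfae_have 1 → 3 := by
    intro h
    refine max_le ?_ ?_
    · rw [div_le_iff₀ hb2]
      exact norm_add_norm_le_of_circle_bound hb fun w hw =>
        (disc_bound_of_exists_map_to_closure hl h hw.le).1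
    · rw [div_le_iff₀ ha2, mul_comm a b]
      exact norm_add_norm_le_of_circle_bound ha fun w hw =>
        (disc_bound_of_exists_map_to_closure hl h hw.le).2
  tfae_have 3 → 4 := fun h => (le_total ‖b‖ ‖a‖).imp
    (fun hba => ⟨hba, (le_max_left _ _).trans h⟩) (fun hab => ⟨hab, (le_max_right _ _).trans h⟩)
  tfae_have 4 → 5 := by
    rintro (⟨hba, h⟩ | ⟨hab, h⟩)
    · exact exists_schur_of_norm_le hl hl0 hb hba ((div_le_iff₀ hb2).1 h)
    · rw [div_le_iff₀ ha2, mul_comm a b] at h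
      exact exists_schur_of_norm_le_swap hl hl0 ha hab h
  tfae_have 5 → 2 := exists_map_to_tetrablock_of_schur
  tfae_have 4 ↔ 6 := or_congr
    (and_congr_right fun _ => by
      rw [div_le_iff₀ hb2, norm_add_norm_le_iff_disc_bound hb, hInftyNorm_tetraPsi_le_iff hb])
    (and_congr_right fun _ => by
      rw [div_le_iff₀ ha2, mul_comm a b, norm_add_norm_le_iff_disc_bound ha,
        ← hInftyNorm_tetraPsi_le_iff ha]
      rfl)
  tfae_have 4 ↔ 7 := or_congr
    (and_congr_right fun _ => by
      rw [div_le_iff₀ hb2, norm_add_norm_le_iff_circle_bound hb, circle_bound_iff hr.le])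
    (and_congr_right fun _ => by
      rw [div_le_iff₀ ha2, mul_comm a b, norm_add_norm_le_iff_circle_bound ha,
        circle_bound_iff hr.le])
  tfae_have 4 ↔ 8 := or_congr
    (and_comm.trans (and_congr_left fun _ => by
      rw [div_le_iff₀ hb2, norm_add_norm_le_iff_disc_bound hb,
        forall_ne_zero_iff_disc_bound hl0 hb]))
    (and_comm.trans (and_congr_left fun _ => by
      rw [div_le_iff₀ ha2, mul_comm a b, norm_add_norm_le_iff_disc_bound ha,
        ← forall_ne_zero_iff_disc_bound hl0 ha]
      have e : ∀ z w : ℂ, l - a * l * z - b * w + p * z * w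
          = l - b * w - a * l * z + p * w * z := fun z w => by ring
      simp only [e]
      exact ⟨fun h z hz w hw => h w hw z hz, fun h z hz w hw => h w hw z hz⟩))
  tfae_have 4 ↔ 9 := or_congr
    (and_congr_right fun _ => by rw [div_le_iff₀ hb2, symmetric_sum_le_iff hr hb])
    (and_congr_right fun _ => by
      rw [div_le_iff₀ ha2, mul_comm a b, symmetric_sum_le_iff hr ha])
  tfae_have 4 ↔ 10 := or_congr
    (and_congr_right fun _ => by
      rw [div_le_iff₀ hb2, norm_add_norm_le_iff_area hb, norm_mul])
    (and_congr_right fun _ => by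
      rw [div_le_iff₀ ha2, mul_comm a b, norm_add_norm_le_iff_area ha, norm_mul])
  tfae_have 9 ↔ 11 := or_congr
    (and_congr_right fun _ => symmetric_sum_le_iff_exists hl0 hb)
    (and_congr_right fun _ => by
      rw [symmetric_sum_le_iff_exists hl0 ha]
      refine and_congr_right fun _ => ⟨?_, ?_⟩ <;>
      · rintro ⟨β₁, β₂, h, h₁, h₂⟩
        exact ⟨β₂, β₁, by rwa [add_comm], h₂, h₁⟩)
  tfae_finish
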